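/- For $n\in\mathbb N$ let $[n]=\{1,\dots,n\}$ and let $2^{[n]}$ be its power set, ordered by the simplicial ordering: for distinct $x,y\subseteq[n]$, $x$ precedes $y$ if $|x|<|y|$, or if $|x|=|y|$ and $\min(x\triangle y)\in x$. For $0\le m\le 2^n$ let $\mathcal I_m$ be the set of the first $m$ elements of $2^{[n]}$ in this ordering. For $A\subseteq 2^{[n]}$ and $p\in\mathbb N$ put $$C^p[A]=\{y\in 2^{[n]} : |x\triangle y|\le p\text{ for every }x\in A\},\qquad C^p(A)=C^p[A]\setminus A .$$ Corollary 3.4. Let $n,p\in\mathbb N$ and let $A\subseteq 2^{[n]}$ be such that $|x\triangle y|\le p$ for all $x,y\in A$. Then $$|C^p(A)|\le |C^p(\mathcal I_{|A|})| .$$ -/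

import Mathlib

namespace Hypercube

/-- The vertices of the hypercube `Q_n`: the subsets of an `n`-element linearly ordered set.
The ground set `{1, …, n}` is represented by `Fin n` with its usual order. -/
abbrev Vertex (n : ℕ) : Type := Finset (Fin n)

/-- `x` strictly precedes `y` in the simplicial ordering: `|x| < |y|`, or `|x| = |y|` and the
smallest element of `x ∆ y` lies in `x` (in particular `x ∆ y` is nonempty, so `x ≠ y`). -/
def Precedes {n : ℕ} (x y : Vertex n) : Prop :=
  x.card < y.card ∨
    (x.card = y.card ∧ ∃ i ∈ x, i ∈ symmDiff x y ∧ ∀ j ∈ symmDiff x y, i ≤ j)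

instance {n : ℕ} (x y : Vertex n) : Decidable (Precedes x y) := by
  unfold Precedes
  infer_instance

/-- The initial segment `I_m`: the first `m` vertices in the simplicial ordering, that is, the
vertices that are preceded by fewer than `m` vertices. -/
def initialSegment (n m : ℕ) : Finset (Vertex n) :=
  Finset.univ.filter fun x => (Finset.univ.filter fun y : Vertex n => Precedes y x).card < m

/-- `C^p[A]`: the vertices at symmetric-difference distance at most `p` from every element
of `A`. -/
def closedCommonNbrs {n : ℕ} (p : ℕ) (A : Finset (Vertex n)) : Finset (Vertex n) :=
  Finset.univ.filter fun y => ∀ x ∈ A, (symmDiff x y).card ≤ p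

/-- `C^p(A) = C^p[A] \ A`. -/
def commonNbrs {n : ℕ} (p : ℕ) (A : Finset (Vertex n)) : Finset (Vertex n) :=
  closedCommonNbrs p A \ A

end Hypercube

/-! Since $|x\triangle y^c| = n-|x\triangle y|$, for $p<n$ complementation carries $C^p[A]$ onto the
complement of the ball of radius $n-p-1$ about $A$. Maximising $|C^p[A]|$ for given $|A|$ is thus
minimising a ball, and Harper's theorem says that initial segments do this. The diameter hypothesis
gives $A\subseteq C^p[A]$, so passing to $C^p(A)$ subtracts exactly $|A|$, while for the initial
segment at most $|A|$ is lost.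

Harper's theorem for radius 1 (`card_ball_one_initialSegment_le`) goes by induction on the
dimension, with compressions: replacing both sections in a direction by initial segments does not
enlarge the ball. A family fixed by every compression is an initial segment, or becomes one when a
single vertex is exchanged for its complement, and that exchange does not enlarge the ball either.
Larger radii follow by iteration, because the ball about an initial segment is again initial. -/

namespace Hypercube

open Finset

/-! ### The simplicial ordering and its initial segments. -/

section Order

variable {n : ℕ}

theorem precedes_iff {x y : Vertex n} :
    Precedes x y ↔ x.card < y.card ∨
      (x.card = y.card ∧ ∃ i ∈ x, i ∉ y ∧ ∀ j < i, (j ∈ x ↔ j ∈ y)) := by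
  unfold Precedes
  refine or_congr Iff.rfl (and_congr Iff.rfl (exists_congr fun i => and_congr_right fun hi => ?_))
  simp only [mem_symmDiff]
  constructor
  · rintro ⟨h, h'⟩
    refine ⟨by tauto, fun j hj => ?_⟩
    by_contra hc
    exact absurd (h' j (by tauto)) (not_le.2 hj)
  · rintro ⟨h, h'⟩
    refine ⟨by tauto, fun j hj => ?_⟩
    by_contra hc
    have := h' j (not_le.1 hc)
    tauto

theorem Precedes.card_le {x y : Vertex n} (h : Precedes x y) : x.card ≤ y.card := by
  rcases h with h | h
  · exact h.le
  · exact h.1.le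

theorem Precedes.trans {x y z : Vertex n} (h : Precedes x y) (h' : Precedes y z) :
    Precedes x z := by
  rw [precedes_iff] at *
  rcases h with h | ⟨h, i, hix, hiy, hi⟩ <;> rcases h' with h' | ⟨h', j, hjy, hjz, hj⟩
  · left; omega
  · left; omega
  · left; omega
  · right
    refine ⟨h.trans h', ?_⟩
    rcases lt_trichotomy i j with hij | hij | hij
    · exact ⟨i, hix, fun hz => hiy ((hj i hij).2 hz),
        fun k hk => (hi k hk).trans (hj k (hk.trans hij))⟩
    · subst hij; exact absurd hjy hiy
    · exact ⟨j, (hi j hij).2 hjy, hjz, fun k hk => (hi k (hk.trans hij)).trans (hj k hk)⟩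

theorem not_precedes_self (x : Vertex n) : ¬ Precedes x x := by
  rw [precedes_iff]
  rintro (h | ⟨-, i, h, h', -⟩)
  · exact lt_irrefl _ h
  · exact h' h

theorem precedes_or_precedes_of_ne {x y : Vertex n} (h : x ≠ y) :
    Precedes x y ∨ Precedes y x := by
  rcases lt_trichotomy x.card y.card with hc | hc | hc
  · exact .inl (.inl hc)
  · have hne : (symmDiff x y).Nonempty := by
      rw [nonempty_iff_ne_empty]
      exact fun h0 => h (symmDiff_eq_bot.1 h0)
    have hm := min'_mem _ hne
    have hle : ∀ j ∈ symmDiff x y, (symmDiff x y).min' hne ≤ j := fun j hj => min'_le _ j hj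
    rcases mem_symmDiff.1 hm with hx | hy
    · exact .inl (.inr ⟨hc, _, hx.1, hm, hle⟩)
    · refine .inr (.inr ⟨hc.symm, _, hy.1, ?_⟩)
      rw [symmDiff_comm y x]
      exact ⟨hm, hle⟩
  · exact .inr (.inl hc)

/-- The number of vertices preceding `x` in the simplicial ordering. -/
def rank (x : Vertex n) : ℕ := (univ.filter fun y : Vertex n => Precedes y x).card

theorem mem_initialSegment {m : ℕ} {x : Vertex n} : x ∈ initialSegment n m ↔ rank x < m := by
  simp [initialSegment, rank]

theorem Precedes.rank_lt {x y : Vertex n} (h : Precedes x y) : rank x < rank y := by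
  apply card_lt_card
  rw [Finset.ssubset_iff_of_subset]
  · exact ⟨x, by simpa using h, by simpa using not_precedes_self x⟩
  · intro z hz
    simp only [mem_filter, mem_univ, true_and] at hz ⊢
    exact hz.trans h

theorem precedes_iff_rank_lt {x y : Vertex n} : Precedes x y ↔ rank x < rank y := by
  refine ⟨Precedes.rank_lt, fun h => ?_⟩
  have hne : x ≠ y := by rintro rfl; exact lt_irrefl _ h
  rcases precedes_or_precedes_of_ne hne with h' | h'
  · exact h'
  · exact absurd h'.rank_lt (by omega)

theorem rank_injective : Function.Injective (rank (n := n)) := by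
  intro x y h
  by_contra hne
  rcases precedes_or_precedes_of_ne hne with h' | h' <;> have := h'.rank_lt <;> omega

theorem rank_lt_card (x : Vertex n) : rank x < Fintype.card (Vertex n) := by
  refine (card_lt_univ_of_notMem (x := x) ?_)
  simpa using not_precedes_self x

/-- Ranks are injective and smaller than the number of vertices, so every possible value is taken
exactly once. -/
theorem card_initialSegment {m : ℕ} (hm : m ≤ Fintype.card (Vertex n)) :
    (initialSegment n m).card = m := by
  have hinj : Function.Injective
      (fun x : Vertex n => (⟨rank x, rank_lt_card x⟩ : Fin (Fintype.card (Vertex n)))) := by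
    intro x y h
    exact rank_injective (by simpa using h)
  have hsurj := ((Fintype.bijective_iff_injective_and_card _).2 ⟨hinj, by simp⟩).2
  have : (initialSegment n m).image rank = range m := by
    ext k
    simp only [mem_image, mem_initialSegment, mem_range]
    constructor
    · rintro ⟨x, hx, rfl⟩; exact hx
    · intro hk
      obtain ⟨x, hx⟩ := hsurj ⟨k, by omega⟩
      have hx' : rank x = k := by simpa using hx
      exact ⟨x, by omega, hx'⟩
  rw [← card_image_of_injective _ rank_injective, this, card_range]

theorem initialSegment_mono {m m' : ℕ} (h : m ≤ m') :
    initialSegment n m ⊆ initialSegment n m' := by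
  intro x hx
  rw [mem_initialSegment] at *
  omega

/-- A family of vertices closed under predecessors in the simplicial ordering. -/
def IsInitial (A : Finset (Vertex n)) : Prop := ∀ y ∈ A, ∀ x, Precedes x y → x ∈ A

theorem isInitial_initialSegment (n m : ℕ) : IsInitial (initialSegment n m) := by
  intro y hy x hxy
  rw [mem_initialSegment] at *
  exact hxy.rank_lt.trans hy

theorem IsInitial.eq_initialSegment {A : Finset (Vertex n)} (h : IsInitial A) :
    A = initialSegment n A.card := by
  refine eq_of_subset_of_card_le (fun y hy => ?_) (card_initialSegment (card_le_univ A)).le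
  rw [mem_initialSegment]
  apply card_lt_card
  rw [Finset.ssubset_iff_of_subset]
  · exact ⟨y, hy, by simpa using not_precedes_self y⟩
  · intro x hx
    exact h y hy x (by simpa using hx)

theorem IsInitial.subset_or_subset {A B : Finset (Vertex n)} (hA : IsInitial A)
    (hB : IsInitial B) : A ⊆ B ∨ B ⊆ A := by
  rw [hA.eq_initialSegment, hB.eq_initialSegment]
  exact (le_total A.card B.card).imp initialSegment_mono initialSegment_mono

theorem IsInitial.card_union {A B : Finset (Vertex n)} (hA : IsInitial A)
    (hB : IsInitial B) : (A ∪ B).card = max A.card B.card := by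
  rcases hA.subset_or_subset hB with h | h
  · rw [union_eq_right.2 h, max_eq_right (card_le_card h)]
  · rw [union_eq_left.2 h, max_eq_left (card_le_card h)]

/-- Outside their intersection the two families have equal size, and every vertex of the segment
precedes every vertex of $A$ there. The strict part makes compression terminate. -/
theorem sum_initialSegment_le {f : Vertex n → ℕ} (hf : ∀ x y, Precedes x y → f x < f y)
    (A : Finset (Vertex n)) : ∑ x ∈ initialSegment n A.card, f x ≤ ∑ x ∈ A, f x ∧
      (A ≠ initialSegment n A.card → ∑ x ∈ initialSegment n A.card, f x < ∑ x ∈ A, f x) := by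
  set I := initialSegment n A.card with hI
  have hcard : I.card = A.card := card_initialSegment (card_le_univ A)
  have key : A ≠ I → ∑ x ∈ I, f x < ∑ x ∈ A, f x := by
    intro hne
    have hc : (I \ A).card = (A \ I).card := card_sdiff_comm hcard
    have hpos : (I \ A).Nonempty := by
      rw [sdiff_nonempty]
      exact fun h => hne (eq_of_subset_of_card_le h hcard.ge).symm
    have hlt : ∀ x ∈ I \ A, ∀ y ∈ A \ I, f x < f y := by
      intro x hx y hy
      rw [mem_sdiff, hI, mem_initialSegment] at hx hy
      exact hf x y (precedes_iff_rank_lt.2 (by omega))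
    obtain ⟨x, hx, hmax⟩ := exists_max_image _ f hpos
    have h1 : ∑ z ∈ I \ A, f z ≤ (I \ A).card • f x := sum_le_card_nsmul _ _ _ hmax
    have h2 : (A \ I).card • (f x + 1) ≤ ∑ z ∈ A \ I, f z :=
      card_nsmul_le_sum _ _ _ fun y hy => hlt x hx y hy
    have h3 := card_pos.2 hpos
    have e1 := sum_inter_add_sum_sdiff I A f
    have e2 := sum_inter_add_sum_sdiff A I f
    rw [inter_comm] at e2
    rw [← hc] at h2
    simp only [smul_eq_mul, mul_add, mul_one] at h1 h2
    omega
  refine ⟨?_, key⟩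
  by_cases h : A = I
  · rw [← h]
  · exact (key h).le

end Order

/-! ### Balls about families, and why they preserve initial segments. -/

section Ball

variable {n : ℕ}

/-- The vertices within distance `r` of some vertex of `A`. -/
def ball (r : ℕ) (A : Finset (Vertex n)) : Finset (Vertex n) :=
  univ.filter fun y => ∃ x ∈ A, (symmDiff x y).card ≤ r

theorem mem_ball {r : ℕ} {A : Finset (Vertex n)} {y : Vertex n} :
    y ∈ ball r A ↔ ∃ x ∈ A, (symmDiff x y).card ≤ r := by
  simp [ball]

theorem ball_mono {r : ℕ} {A B : Finset (Vertex n)} (h : A ⊆ B) : ball r A ⊆ ball r B := by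
  intro y hy
  obtain ⟨x, hx, hxy⟩ := mem_ball.1 hy
  exact mem_ball.2 ⟨x, h hx, hxy⟩

theorem subset_ball {r : ℕ} (A : Finset (Vertex n)) : A ⊆ ball r A :=
  fun x hx => mem_ball.2 ⟨x, hx, by simp⟩

theorem ball_zero (A : Finset (Vertex n)) : ball 0 A = A := by
  ext y
  rw [mem_ball]
  constructor
  · rintro ⟨x, hx, h⟩
    rw [Nat.le_zero, card_eq_zero] at h
    rwa [← symmDiff_eq_bot.1 h]
  · intro hy
    exact ⟨y, hy, by simp⟩

theorem card_symmDiff_le_add (x y z : Vertex n) :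
    (symmDiff x z).card ≤ (symmDiff x y).card + (symmDiff y z).card :=
  (card_le_card (symmDiff_triangle x y z)).trans (card_union_le _ _)

theorem ball_succ (r : ℕ) (A : Finset (Vertex n)) : ball (r + 1) A = ball 1 (ball r A) := by
  ext y
  simp only [mem_ball]
  constructor
  · rintro ⟨x, hx, h⟩
    rcases (symmDiff x y).eq_empty_or_nonempty with h0 | ⟨j, hj⟩
    · exact ⟨y, ⟨x, hx, by simp [h0]⟩, by simp⟩
    -- Flipping a coordinate where $y$ differs from $x$ brings it one step closer to $x$.
    · refine ⟨symmDiff y {j}, ⟨x, hx, ?_⟩, ?_⟩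
      · have : symmDiff x (symmDiff y {j}) = (symmDiff x y).erase j := by
          ext k
          simp only [mem_symmDiff, mem_singleton, mem_erase] at hj ⊢
          by_cases hk : k = j
          · subst hk; tauto
          · tauto
        rw [this, card_erase_of_mem hj]
        omega
      · rw [symmDiff_comm, symmDiff_symmDiff_cancel_left]
        simp
  · rintro ⟨z, ⟨x, hx, h⟩, h'⟩
    exact ⟨x, hx, (card_symmDiff_le_add x z y).trans (by omega)⟩

theorem card_symmDiff_le_one {x y : Vertex n} (h : (symmDiff x y).card ≤ 1) :
    y = x ∨ (∃ j ∈ x, y = x.erase j) ∨ ∃ j ∉ x, y = insert j x := by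
  rcases isEmpty_or_nonempty (Fin n) with h0 | h0
  · left; ext k; exact h0.elim k
  · obtain ⟨j, hj⟩ := card_le_one_iff_subset_singleton.1 h
    have hk : ∀ k, k ≠ j → (k ∈ x ↔ k ∈ y) := by
      intro k hk
      have := mt (@hj k)
      simp only [mem_symmDiff, mem_singleton] at this
      tauto
    by_cases hjx : j ∈ x <;> by_cases hjy : j ∈ y
    · left; ext k; by_cases h : k = j
      · subst h; tauto
      · exact (hk k h).symm
    · right; left; refine ⟨j, hjx, ?_⟩; ext k; by_cases h : k = j
      · subst h; simp [hjy]
      · simp [h, hk k h]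
    · right; right; refine ⟨j, hjx, ?_⟩; ext k; by_cases h : k = j
      · subst h; simp [hjy]
      · simp [h, hk k h]
    · left; ext k; by_cases h : k = j
      · subst h; tauto
      · exact (hk k h).symm

theorem card_symmDiff_erase_le (x : Vertex n) (j : Fin n) : (symmDiff (x.erase j) x).card ≤ 1 := by
  refine (card_le_card (t := {j}) fun k => ?_).trans (by simp)
  simp only [mem_symmDiff, mem_erase, mem_singleton]
  tauto

theorem precedes_erase {x : Vertex n} {j : Fin n} (hj : j ∈ x) : Precedes (x.erase j) x :=
  .inl (card_erase_lt_of_mem hj)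

/-- Let $i$ be the first difference of $z$ and $y$. If $j<i$, delete $j$ from both. Otherwise delete
from $z$ an element beyond $i$, which keeps $i$ as a first difference; if there is none, deleting
$i$ leaves a subset of $y\setminus\{j\}$ of the same size. -/
theorem exists_erase_precedes {y z : Vertex n} {j : Fin n} (hj : j ∈ y) (hc : z.card = y.card)
    (h : Precedes z y) : ∃ k ∈ z, z.erase k = y.erase j ∨ Precedes (z.erase k) (y.erase j) := by
  rw [precedes_iff] at h
  obtain ⟨-, i, hiz, hiy, hi⟩ := h.resolve_left (by omega)
  have hcard : ∀ k ∈ z, (z.erase k).card = (y.erase j).card := by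
    intro k hk
    rw [card_erase_of_mem hk, card_erase_of_mem hj, hc]
  rcases lt_trichotomy j i with hji | rfl | hij
  · have hjz := (hi j hji).2 hj
    refine ⟨j, hjz, .inr (precedes_iff.2 (.inr ⟨hcard j hjz, i, ?_, ?_, ?_⟩))⟩
    · simp [hiz, hji.ne']
    · simp [hiy]
    · intro k hk; simp [hi k hk]
  · exact absurd hj hiy
  · by_cases hk : ∃ k ∈ z, i < k
    · obtain ⟨k, hkz, hik⟩ := hk
      refine ⟨k, hkz, .inr (precedes_iff.2 (.inr ⟨hcard k hkz, i, ?_, ?_, ?_⟩))⟩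
      · simp [hiz, hik.ne]
      · simp [hiy]
      · intro l hl
        simp [hi l hl, (hl.trans hik).ne, (hl.trans hij).ne]
    · push Not at hk
      refine ⟨i, hiz, .inl (eq_of_subset_of_card_le ?_ (hcard i hiz).ge)⟩
      intro l hl
      rw [mem_erase] at hl
      have hli : l < i := lt_of_le_of_ne (hk l hl.2) hl.1
      rw [mem_erase]
      exact ⟨(hli.trans hij).ne, (hi l hli).1 hl.2⟩

theorem IsInitial.ball_one {A : Finset (Vertex n)} (hA : IsInitial A) : IsInitial (ball 1 A) := by
  intro y hy z hzy
  obtain ⟨w, hw, hwy⟩ := mem_ball.1 hy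
  have hyA : y ∈ A → z ∈ ball 1 A := fun h => subset_ball A (hA y h z hzy)
  rcases card_symmDiff_le_one hwy with rfl | ⟨j, hj, rfl⟩ | ⟨j, hj, rfl⟩
  · exact hyA hw
  · exact hyA (hA w hw _ (precedes_erase hj))
  -- The only real case: $y$ lies one level above $w\in A$, so $z$ must be reached from some
  -- $z\setminus\{k\}$ in $A$.
  · have hcard := card_insert_of_notMem hj
    have hle := hzy.card_le
    rcases hle.lt_or_eq with hlt | heq
    · rcases z.eq_empty_or_nonempty with rfl | ⟨k, hk⟩
      · rcases eq_or_ne w ∅ with rfl | hne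
        · exact subset_ball A hw
        · exact subset_ball A (hA w hw _ (.inl (by simpa [card_pos, nonempty_iff_ne_empty])))
      · refine mem_ball.2 ⟨z.erase k, hA w hw _ (.inl ?_), card_symmDiff_erase_le z k⟩
        have := card_erase_lt_of_mem hk
        omega
    · obtain ⟨k, hk, h⟩ := exists_erase_precedes (mem_insert_self j w) heq hzy
      rw [erase_insert hj] at h
      refine mem_ball.2 ⟨z.erase k, ?_, card_symmDiff_erase_le z k⟩
      rcases h with h | h
      · rwa [h]
      · exact hA w hw _ h

theorem IsInitial.ball {A : Finset (Vertex n)} (hA : IsInitial A) (r : ℕ) :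
    IsInitial (ball r A) := by
  induction r with
  | zero => rwa [ball_zero]
  | succ r ih => rw [ball_succ]; exact ih.ball_one

end Ball

/-! ### Sections of the cube and compressions. -/

section Compression

variable {n : ℕ}

/-- The vertex of the hypercube of dimension `n + 1` whose `i`-th coordinate is `b` and whose other
coordinates are those of `s`. -/
def lift (i : Fin (n + 1)) (b : Bool) (s : Vertex n) : Vertex (n + 1) :=
  univ.filter fun j => (j = i ∧ b = true) ∨ ∃ k ∈ s, i.succAbove k = j

@[simp] theorem self_mem_lift {i : Fin (n + 1)} {b : Bool} {s : Vertex n} :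
    i ∈ lift i b s ↔ b = true := by
  simp [lift, Fin.succAbove_ne]

@[simp] theorem succAbove_mem_lift {i : Fin (n + 1)} {b : Bool} {s : Vertex n} {k : Fin n} :
    i.succAbove k ∈ lift i b s ↔ k ∈ s := by
  simp [lift, Fin.succAbove_ne]

theorem lift_eq_iff {i : Fin (n + 1)} {b : Bool} {s : Vertex n} {x : Vertex (n + 1)} :
    lift i b s = x ↔ (b = true ↔ i ∈ x) ∧ ∀ k, k ∈ s ↔ i.succAbove k ∈ x := by
  rw [Finset.ext_iff, Fin.forall_iff_succAbove i]
  simp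

theorem lift_bijective (i : Fin (n + 1)) :
    Function.Bijective fun q : Bool × Vertex n => lift i q.1 q.2 := by
  constructor
  · rintro ⟨b, s⟩ ⟨c, t⟩ h
    have h' := lift_eq_iff.1 h
    simp only [self_mem_lift, succAbove_mem_lift] at h'
    exact Prod.ext (Bool.eq_iff_iff.2 h'.1) (Finset.ext h'.2)
  · intro x
    refine ⟨(decide (i ∈ x), univ.filter fun k => i.succAbove k ∈ x), ?_⟩
    exact lift_eq_iff.2 (by simp)

theorem exists_lift (i : Fin (n + 1)) (x : Vertex (n + 1)) : ∃ b s, lift i b s = x := by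
  obtain ⟨⟨b, s⟩, h⟩ := (lift_bijective i).2 x
  exact ⟨b, s, h⟩

theorem symmDiff_lift (i : Fin (n + 1)) (b c : Bool) (s t : Vertex n) :
    symmDiff (lift i b s) (lift i c t) = lift i (xor b c) (symmDiff s t) := by
  refine (lift_eq_iff.2 ?_).symm
  simp only [mem_symmDiff, self_mem_lift, succAbove_mem_lift, implies_true, and_true]
  cases b <;> cases c <;> simp

theorem card_lift (i : Fin (n + 1)) (b : Bool) (s : Vertex n) :
    (lift i b s).card = b.toNat + s.card := by
  have : lift i b s = (if b then {i} else ∅) ∪ s.map i.succAboveEmb := by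
    refine lift_eq_iff.2 ?_
    cases b <;> simp [Fin.succAbove_ne]
  rw [this, card_union_of_disjoint]
  · cases b <;> simp
  · cases b <;> simp [Fin.succAbove_ne]

/-- `Fin.succAbove` is order preserving, so a first difference stays one; the converse follows from
totality. -/
theorem precedes_lift {i : Fin (n + 1)} {b : Bool} {s t : Vertex n} :
    Precedes (lift i b s) (lift i b t) ↔ Precedes s t := by
  have hmp : ∀ s t : Vertex n, Precedes s t → Precedes (lift i b s) (lift i b t) := by
    intro s t h
    rw [precedes_iff] at *
    simp only [card_lift]
    refine h.imp (fun h => by omega) ?_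
    rintro ⟨h, k, hks, hkt, hk⟩
    refine ⟨by omega, i.succAbove k, by simpa, by simpa, ?_⟩
    rw [Fin.forall_iff_succAbove i]
    refine ⟨by simp, fun l hl => ?_⟩
    simpa using hk l (Fin.succAbove_lt_succAbove_iff.1 hl)
  refine ⟨fun h => ?_, hmp s t⟩
  rcases eq_or_ne s t with rfl | hne
  · exact absurd h (not_precedes_self _)
  · exact (precedes_or_precedes_of_ne hne).resolve_right
      fun h' => not_precedes_self _ (h.trans (hmp t s h'))

/-- The section of `A` at the value `b` of the `i`-th coordinate. -/
def slice (i : Fin (n + 1)) (A : Finset (Vertex (n + 1))) (b : Bool) : Finset (Vertex n) :=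
  univ.filter fun s => lift i b s ∈ A

@[simp] theorem mem_slice {i : Fin (n + 1)} {A : Finset (Vertex (n + 1))} {b : Bool}
    {s : Vertex n} : s ∈ slice i A b ↔ lift i b s ∈ A := by
  simp [slice]

theorem sum_eq_sum_slice (i : Fin (n + 1)) (A : Finset (Vertex (n + 1)))
    (f : Vertex (n + 1) → ℕ) :
    ∑ x ∈ A, f x = ∑ b, ∑ s ∈ slice i A b, f (lift i b s) := by
  calc ∑ x ∈ A, f x = ∑ x, if x ∈ A then f x else 0 := by simp
    _ = ∑ q : Bool × Vertex n, if lift i q.1 q.2 ∈ A then f (lift i q.1 q.2) else 0 :=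
      ((lift_bijective i).sum_comp fun x => if x ∈ A then f x else 0).symm
    _ = _ := by simp only [Fintype.sum_prod_type, slice, sum_filter]

theorem card_eq_sum_slice (i : Fin (n + 1)) (A : Finset (Vertex (n + 1))) :
    A.card = ∑ b, (slice i A b).card := by
  simpa using sum_eq_sum_slice i A fun _ => 1

/-- The two halves of the cube in direction $i$ are joined by a perfect matching. -/
theorem slice_ball_one (i : Fin (n + 1)) (A : Finset (Vertex (n + 1))) (b : Bool) :
    slice i (ball 1 A) b = ball 1 (slice i A b) ∪ slice i A (!b) := by
  ext s
  simp only [mem_slice, mem_ball, mem_union]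
  constructor
  · rintro ⟨x, hx, h⟩
    obtain ⟨c, t, rfl⟩ := exists_lift i x
    rw [symmDiff_lift, card_lift] at h
    by_cases hbc : c = b
    · subst hbc
      exact .inl ⟨t, hx, by simpa using h⟩
    · have hc : c = !b := Bool.eq_not.2 hbc
      subst hc
      have h0 : (symmDiff t s).card = 0 := by
        simp at h
        simp [h]
      rw [card_eq_zero] at h0
      rw [← symmDiff_eq_bot.1 h0]
      exact .inr hx
  · rintro (⟨t, ht, h⟩ | h)
    · exact ⟨_, ht, by rw [symmDiff_lift, card_lift]; simpa using h⟩
    · exact ⟨_, h, by rw [symmDiff_lift, card_lift]; simp⟩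

/-- The `i`-compression of `A`: each of the two sections in direction `i` is replaced by the initial
segment of the same size. -/
def compress (i : Fin (n + 1)) (A : Finset (Vertex (n + 1))) : Finset (Vertex (n + 1)) :=
  univ.filter fun x => ∃ b, ∃ s ∈ initialSegment n (slice i A b).card, lift i b s = x

theorem slice_compress (i : Fin (n + 1)) (A : Finset (Vertex (n + 1))) (b : Bool) :
    slice i (compress i A) b = initialSegment n (slice i A b).card := by
  ext s
  simp only [mem_slice, compress, mem_filter, mem_univ, true_and]
  constructor
  · rintro ⟨c, t, ht, h⟩
    have := (lift_bijective i).1 (a₁ := (c, t)) (a₂ := (b, s)) h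
    rw [Prod.mk.injEq] at this
    rwa [← this.1, ← this.2]
  · intro h
    exact ⟨b, s, h, rfl⟩

theorem card_compress (i : Fin (n + 1)) (A : Finset (Vertex (n + 1))) :
    (compress i A).card = A.card := by
  rw [card_eq_sum_slice i, card_eq_sum_slice i A]
  refine sum_congr rfl fun b _ => ?_
  rw [slice_compress, card_initialSegment (card_le_univ _)]

theorem sum_rank_compress_lt {i : Fin (n + 1)} {A : Finset (Vertex (n + 1))} {b : Bool}
    (h : slice i A b ≠ initialSegment n (slice i A b).card) :
    ∑ x ∈ compress i A, rank x < ∑ x ∈ A, rank x := by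
  rw [sum_eq_sum_slice i, sum_eq_sum_slice i A]
  have hmono : ∀ c, ∀ s t : Vertex n, Precedes s t → rank (lift i c s) < rank (lift i c t) :=
    fun c s t hst => (precedes_lift.2 hst).rank_lt
  refine sum_lt_sum (fun c _ => ?_) ⟨b, mem_univ b, ?_⟩
  · rw [slice_compress]
    exact (sum_initialSegment_le (hmono c) _).1
  · rw [slice_compress]
    exact (sum_initialSegment_le (hmono b) _).2 h

/-- After compression each section of the ball is a union of two initial segments. These are nested,
so its size is the larger of the two, and both are bounded by the corresponding section for $A$. -/
theorem card_ball_compress_le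
    (ih : ∀ A : Finset (Vertex n), (ball 1 (initialSegment n A.card)).card ≤ (ball 1 A).card)
    (i : Fin (n + 1)) (A : Finset (Vertex (n + 1))) :
    (ball 1 (compress i A)).card ≤ (ball 1 A).card := by
  rw [card_eq_sum_slice i, card_eq_sum_slice i (ball 1 A)]
  refine sum_le_sum fun b _ => ?_
  rw [slice_ball_one, slice_ball_one, slice_compress, slice_compress,
    (isInitial_initialSegment n _).ball_one.card_union (isInitial_initialSegment n _),
    card_initialSegment (card_le_univ _)]
  exact max_le ((ih _).trans (card_le_card subset_union_left)) (card_le_card subset_union_right)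

end Compression

/-! ### Harper's vertex-isoperimetric inequality. -/

section Harper

variable {n : ℕ}

/-- If $x$ and $y$ agreed in a coordinate, they would lie in a common section, which is initial and
would contain $x$ along with $y$. -/
theorem eq_compl_of_slices_initial {A : Finset (Vertex (n + 1))}
    (hA : ∀ i b, slice i A b = initialSegment n (slice i A b).card) {x y : Vertex (n + 1)}
    (hx : x ∉ A) (hy : y ∈ A) (hxy : Precedes x y) : x = yᶜ := by
  ext i
  rw [mem_compl]
  obtain ⟨b, s, rfl⟩ := exists_lift i x
  obtain ⟨c, t, rfl⟩ := exists_lift i y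
  by_cases h : b = c
  · subst h
    have hi : IsInitial (slice i A b) := by
      rw [hA i b]
      exact isInitial_initialSegment n _
    exact absurd (mem_slice.1 (hi t (mem_slice.2 hy) s (precedes_lift.1 hxy))) hx
  · simp only [self_mem_lift]
    cases b <;> cases c <;> simp at h ⊢

/-- Replacing an element of `x` by the last point of the ground set moves `x` forward. -/
theorem precedes_insert_erase {x : Vertex (n + 1)} (hl : Fin.last n ∉ x) {a : Fin (n + 1)}
    (ha : a ∈ x) : Precedes x (insert (Fin.last n) (x.erase a)) := by
  have hal : a ≠ Fin.last n := by rintro rfl; exact hl ha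
  refine precedes_iff.2 (.inr ⟨?_, a, ha, by simp [hal], fun j hj => ?_⟩)
  · rw [card_insert_of_notMem (by simp [hl]), card_erase_of_mem ha]
    have := card_pos.2 ⟨a, ha⟩
    omega
  · have : j ≠ Fin.last n := (hj.trans_le (Fin.le_last a)).ne
    simp [hj.ne, this]

/-- If the last point were missing from a nonempty $x$, exchanging a suitable element of $x$ for it
would give a vertex strictly between $x$ and $x^c$. -/
theorem last_mem_of_covBy_compl (hn : 2 ≤ n) {x : Vertex (n + 1)} (hx : Precedes x xᶜ)
    (hcov : ∀ z, Precedes x z → ¬ Precedes z xᶜ) : Fin.last n ∈ x := by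
  have hcard : x.card + xᶜ.card = n + 1 := by
    rw [card_add_card_compl, Fintype.card_fin]
  by_contra hl
  rcases hx.card_le.lt_or_eq with hlt | heq
  · rcases x.eq_empty_or_nonempty with rfl | ⟨a, ha⟩
    · refine hcov {0} (.inl (by simp)) (.inl ?_)
      simp only [card_empty] at hcard
      simp only [card_singleton]
      omega
    · have h := precedes_insert_erase hl ha
      refine hcov _ h (.inl ?_)
      rw [card_insert_of_notMem (by simp [hl])]
      have := card_erase_lt_of_mem ha
      omega
  -- On the middle level, $x$ precedes $x^c$ because $0\in x$. Here $n\ge 2$ gives $|x|\ge 2$, so an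
  -- element other than $0$ can be exchanged.
  · obtain ⟨-, i, hi, -, hmin⟩ := (precedes_iff.1 hx).resolve_left (by omega)
    have hi0 : (0 : Fin (n + 1)) ∈ x := by
      by_contra h0
      have hlt : 0 < i := Fin.pos_iff_ne_zero.2 (by rintro rfl; exact h0 hi)
      have := hmin 0 hlt
      simp [h0] at this
    obtain ⟨a, ha, ha0⟩ := exists_mem_ne (s := x) (by omega) 0
    refine hcov _ (precedes_insert_erase hl ha) (precedes_iff.2 (.inr ⟨?_, 0, ?_, ?_, ?_⟩))
    · rw [← heq, card_insert_of_notMem (by simp [hl]), card_erase_of_mem ha]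
      have := card_pos.2 ⟨a, ha⟩
      omega
    · simp [hi0, ha0.symm]
    · simp [hi0]
    · intro j hj
      exact absurd hj (Fin.not_lt_zero j)

/-- Adding $x$ to $A$ gains nothing: a neighbour $x\cup\{j\}$ is also adjacent to $x\cup\{j\}$ with
the last point removed, which precedes $x$. -/
theorem ball_one_subset_of_last_mem {A : Finset (Vertex (n + 1))} {x : Vertex (n + 1)}
    (hl : Fin.last n ∈ x) (hA : ∀ z, Precedes z x → z ∈ A) {w : Vertex (n + 1)}
    (hw : (symmDiff x w).card ≤ 1) : w ∈ ball 1 A := by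
  rcases card_symmDiff_le_one hw with rfl | ⟨j, hj, rfl⟩ | ⟨j, hj, rfl⟩
  · exact mem_ball.2 ⟨_, hA _ (precedes_erase hl), card_symmDiff_erase_le _ _⟩
  · exact subset_ball A (hA _ (precedes_erase hj))
  · have hjl : j ≠ Fin.last n := by rintro rfl; exact hj hl
    refine mem_ball.2 ⟨(insert j x).erase (Fin.last n), hA _ (precedes_iff.2 (.inr ?_)),
      card_symmDiff_erase_le _ _⟩
    refine ⟨?_, j, by simp [hjl], hj, fun k hk => ?_⟩
    · rw [card_erase_of_mem (by simp [hl]), card_insert_of_notMem hj]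
      omega
    · have : k ≠ Fin.last n := (hk.trans_le (Fin.le_last j)).ne
      simp [this, hk.ne]

theorem card_ball_initialSegment_le_of_slices_initial (hn : 2 ≤ n) {A : Finset (Vertex (n + 1))}
    (hA : ∀ i b, slice i A b = initialSegment n (slice i A b).card) :
    (ball 1 (initialSegment (n + 1) A.card)).card ≤ (ball 1 A).card := by
  by_cases hinit : IsInitial A
  · rw [← hinit.eq_initialSegment]
  unfold IsInitial at hinit
  push Not at hinit
  obtain ⟨y, hy, x, hxy, hx⟩ := hinit
  have hxc := eq_compl_of_slices_initial hA hx hy hxy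
  obtain rfl : y = xᶜ := by rw [hxc, compl_compl]
  have hbelow : ∀ z, Precedes z x → z ∈ A := by
    intro z hz
    by_contra hzA
    have := eq_compl_of_slices_initial hA hzA hy (hz.trans hxy)
    rw [← hxc] at this
    subst this
    exact not_precedes_self _ hz
  -- A vertex strictly between $x$ and $x^c$ would, whether or not it lies in $A$, form with one of
  -- them a second violating pair.
  have hcov : ∀ z, Precedes x z → ¬ Precedes z xᶜ := by
    intro z hxz hzy
    by_cases hzA : z ∈ A
    · have := eq_compl_of_slices_initial hA hx hzA hxz
      rw [this, compl_compl] at hzy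
      exact not_precedes_self _ hzy
    · have := eq_compl_of_slices_initial hA hzA hy hzy
      rw [← hxc] at this
      subst this
      exact not_precedes_self _ hxz
  have habove : ∀ z ∈ A, z ≠ xᶜ → Precedes z x := by
    intro z hz hne
    have hzx : z ≠ x := by rintro rfl; exact hx hz
    refine (precedes_or_precedes_of_ne hzx).resolve_right fun h => hne ?_
    rw [eq_compl_of_slices_initial hA hx hz h, compl_compl]
  -- Apart from $x^c$, the family $A$ consists exactly of the predecessors of $x$.
  have hJ : IsInitial (insert x (A.erase xᶜ)) := by
    intro z hz w hwz
    have hwx : Precedes w x := by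
      rcases mem_insert.1 hz with rfl | hz
      · exact hwz
      · rw [mem_erase] at hz
        exact hwz.trans (habove z hz.2 hz.1)
    refine mem_insert_of_mem (mem_erase.2 ⟨?_, hbelow w hwx⟩)
    rintro rfl
    exact not_precedes_self _ (hwx.trans hxy)
  have hJcard : (insert x (A.erase xᶜ)).card = A.card := by
    rw [card_insert_of_notMem (by simp [hx]), card_erase_of_mem hy]
    have := card_pos.2 ⟨_, hy⟩
    omega
  rw [← hJcard, ← hJ.eq_initialSegment]
  refine card_le_card fun w hw => ?_
  obtain ⟨z, hz, hzw⟩ := mem_ball.1 hw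
  rcases mem_insert.1 hz with rfl | hz
  · exact ball_one_subset_of_last_mem (last_mem_of_covBy_compl hn hxy hcov) hbelow hzw
  · exact mem_ball.2 ⟨z, mem_of_mem_erase hz, hzw⟩

/-- The exchange argument needs dimension at least 3, so smaller cubes are checked exhaustively. -/
theorem card_ball_initialSegment_le_of_dim_le_two (n : ℕ) (hn : n ≤ 2) (A : Finset (Vertex n)) :
    (ball 1 (initialSegment n A.card)).card ≤ (ball 1 A).card := by
  unfold ball
  interval_cases n <;> revert A <;> decide +kernel

/-- Harper's vertex-isoperimetric inequality. -/
theorem card_ball_one_initialSegment_le (n : ℕ) (A : Finset (Vertex n)) :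
    (ball 1 (initialSegment n A.card)).card ≤ (ball 1 A).card := by
  induction n with
  | zero => exact card_ball_initialSegment_le_of_dim_le_two 0 (by omega) A
  | succ n ih =>
    by_cases hn : n < 2
    · exact card_ball_initialSegment_le_of_dim_le_two (n + 1) (by omega) A
    -- A compression that changes some section strictly lowers the total rank.
    induction hs : ∑ x ∈ A, rank x using Nat.strong_induction_on generalizing A with
    | _ s ihs =>
      by_cases hA : ∀ i b, slice i A b = initialSegment n (slice i A b).card
      · exact card_ball_initialSegment_le_of_slices_initial (by omega) hA
      · push Not at hA
        obtain ⟨i, b, hib⟩ := hA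
        have := ihs _ (hs ▸ sum_rank_compress_lt hib) (compress i A) rfl
        rw [card_compress] at this
        exact this.trans (card_ball_compress_le ih i A)

theorem card_ball_initialSegment_le (r : ℕ) (A : Finset (Vertex n)) :
    (ball r (initialSegment n A.card)).card ≤ (ball r A).card := by
  induction r with
  | zero => rw [ball_zero, ball_zero, card_initialSegment (card_le_univ A)]
  | succ r ih =>
    rw [ball_succ r, ball_succ r, ((isInitial_initialSegment n A.card).ball r).eq_initialSegment]
    have h : (ball 1 (initialSegment n (ball r (initialSegment n A.card)).card)).card ≤
        (ball 1 (initialSegment n (ball r A).card)).card :=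
      card_le_card (ball_mono (initialSegment_mono ih))
    exact h.trans (card_ball_one_initialSegment_le n (ball r A))

end Harper

/-! ### Common neighbourhoods as complements of balls. -/

section CommonNbrs

variable {n : ℕ}

theorem card_symmDiff_compl (x y : Vertex n) : (symmDiff x yᶜ).card + (symmDiff x y).card = n := by
  have : symmDiff x yᶜ = (symmDiff x y)ᶜ := by
    ext j
    simp only [mem_symmDiff, mem_compl]
    tauto
  rw [this, card_compl_add_card, Fintype.card_fin]

/-- Being within $p$ of $x$ means that the complement is at distance at least $n-p$ from $x$, that
is, not within $n-p-1$. With $p<n$ the truncated subtraction is exact. -/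
theorem compl_map_closedCommonNbrs {p : ℕ} (hp : p < n) (A : Finset (Vertex n)) :
    (closedCommonNbrs p A).image compl = (ball (n - p - 1) A)ᶜ := by
  ext y
  simp only [mem_image, closedCommonNbrs, mem_filter, mem_univ, true_and, mem_compl, mem_ball,
    not_exists, not_and]
  constructor
  · rintro ⟨z, hz, rfl⟩ x hx
    have := card_symmDiff_compl x z
    have := hz x hx
    omega
  · intro h
    refine ⟨yᶜ, fun x hx => ?_, compl_compl y⟩
    have := card_symmDiff_compl x y
    have := h x hx
    omega

theorem card_closedCommonNbrs_add_card_ball {p : ℕ} (hp : p < n) (A : Finset (Vertex n)) :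
    (closedCommonNbrs p A).card + (ball (n - p - 1) A).card = Fintype.card (Vertex n) := by
  rw [← card_image_of_injective _ (compl_injective (α := Vertex n)),
    compl_map_closedCommonNbrs hp, card_compl_add_card]

theorem closedCommonNbrs_eq_univ {p : ℕ} (hp : n ≤ p) (A : Finset (Vertex n)) :
    closedCommonNbrs p A = univ := by
  refine filter_true_of_mem fun y _ x _ => (card_le_univ _).trans ?_
  rwa [Fintype.card_fin]

theorem card_closedCommonNbrs_le (p : ℕ) (A : Finset (Vertex n)) :
    (closedCommonNbrs p A).card ≤ (closedCommonNbrs p (initialSegment n A.card)).card := by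
  rcases lt_or_ge p n with hp | hp
  · have h1 := card_closedCommonNbrs_add_card_ball hp A
    have h2 := card_closedCommonNbrs_add_card_ball hp (initialSegment n A.card)
    have h3 := card_ball_initialSegment_le (n - p - 1) A
    omega
  · rw [closedCommonNbrs_eq_univ hp, closedCommonNbrs_eq_univ hp]

end CommonNbrs

end Hypercube

theorem corollary3p4 (n p : ℕ) (A : Finset (Hypercube.Vertex n))
    (hA : ∀ x ∈ A, ∀ y ∈ A, (symmDiff x y).card ≤ p) :
    (Hypercube.commonNbrs p A).card ≤
      (Hypercube.commonNbrs p (Hypercube.initialSegment n A.card)).card := by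
  have hsub : A ⊆ Hypercube.closedCommonNbrs p A := fun y hy => by
    simpa [Hypercube.closedCommonNbrs] using fun x hx => hA x hx y hy
  have h1 := Finset.card_sdiff_of_subset hsub
  -- Only a lower bound is needed here, so the initial segment need not lie inside its own closed
  -- common neighbourhood.
  have h2 := Finset.le_card_sdiff (Hypercube.initialSegment n A.card)
    (Hypercube.closedCommonNbrs p (Hypercube.initialSegment n A.card))
  rw [Hypercube.card_initialSegment (Finset.card_le_univ A)] at h2
  have h3 := Hypercube.card_closedCommonNbrs_le p A
  unfold Hypercube.commonNbrs
  omega
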